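/- **Proposition (recurrence in a $1/4$-octahedron).** Let $\mathbb F$ be a semifield, i.e. a set with a commutative and associative addition and a multiplication which makes $\mathbb F$ an abelian group and distributes over the addition (so $\mathbb F$ has no zero; examples are $\mathbb R_{>0}$ and $(\mathbb R,\max,+)$). Let $n\ge 0$ be an integer, let $Y=(\mathbb R_{\ge 0})^2\times\mathbb R$, $$A=\{(x,y,t)\in Y \mid x+y-n\le t\le n-(x+y)\},$$ $$S=\mathrm{conv}\{(n,0,0),(0,n,0),(0,0,-n)\},\qquad S'=\mathrm{conv}\{(n,0,0),(0,n,0),(0,0,n)\},$$ and let $\mathcal L=\{(x,y,t)\in\mathbb Z^3\cap Y\mid x+y+t\equiv n \bmod 2\}$. For $D\subset Y$ let $\mathcal H(D)=\mathbb F^{D\cap\mathcal L}$ be the set of states of $D$, and $P\mathcal H(D)=\mathcal H(D)/\mathbb F^\times$ its quotient by the action of the multiplicative group of $\mathbb F$ by scalar multiplication. The bounded octahedron recurrence for a state $f$ of $A$ is the rule $$f(x,y,t+1)\,f(x,y,t-1)=\begin{cases} f(x+1,y,t)f(x-1,y,t)+f(x,y+1,t)f(x,y-1,t) & \text{if } x>0,\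 y>0,\\ f(x+1,0,t)f(x-1,0,t) & \text{if } x>0,\ y=0,\\ f(0,y+1,t)f(0,y-1,t) & \text{if } x=0,\ y>0,\\ f(1,0,t)f(0,1,t) & \text{if } x=y=0,\end{cases}$$ whenever $(x,y,t\pm1)\in A\cap\mathcal L$. Every $f\in\mathcal H(S)$ extends uniquely to a state of $A$ satisfying this recurrence; let $\phi(f)\in\mathcal H(S')$ be the restriction of this extension to $S'$. Since $\phi(cf)=c\,\phi(f)$ for $c\in\mathbb F$, it induces a map $\overline\phi:P\mathcal H(S)\to P\mathcal H(S')$. Let $$r:S\to S,\ (n,0,0)\mapsto(0,n,0)\mapsto(0,0,-n)\mapsto(n,0,0),\qquad r':S'\to S',\ (n,0,0)\mapsto(0,0,n)\mapsto(0,n,0)\mapsto(n,0,0)$$ be the rotations of the two triangles, that is, $r(x,y,t)=(-t,x,-y)$ and $r'(x,y,t)=(y,t,x)$, and let $r^*$ and $r'^*$ be the maps that they induce on $P\mathcal H(S)$ and on $P\mathcal H(S')$ by $f\mapsto f\circ r$ and $f\mapsto f\circ r'$. Then $\phi:\mathcal H(S)\to\mathcal H(S')$ and $\overline\phi:P\mathcal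 H(S)\to P\mathcal H(S')$ are bijections, and $$r'^*\circ\overline\phi=\overline\phi\circ r^*.$$ -/

import Mathlib

/-!
# The bounded octahedron recurrence in a quarter-octahedron
-/

noncomputable section

namespace Octahedron

/-! ### Semifields (without zero) -/

/-- A semifield: a set with a commutative associative addition, and a multiplication that makes
the *whole* set an abelian group and that distributes over the addition.  There is no zero, so this
is not Mathlib's `Semifield`.  Examples: the positive reals, and `ℝ` with `max` and `+`. -/
class ZeroFreeSemifield (F : Type*) extends AddCommSemigroup F, CommGroup F, Distrib F

/-! ### Space-time, lattice, states -/

/-- The space-time `Y = (ℝ_{≥0})² × ℝ`, with coordinates `(x, y, t)`. -/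
def spaceTime : Set (ℝ × ℝ × ℝ) := {p | 0 ≤ p.1 ∧ 0 ≤ p.2.1}

/-- The quarter-octahedron `A = {(x, y, t) ∈ Y | x + y - n ≤ t ≤ n - (x + y)}`. -/
def quarterOctahedron (n : ℕ) : Set (ℝ × ℝ × ℝ) :=
  {p | p ∈ spaceTime ∧ p.1 + p.2.1 - n ≤ p.2.2 ∧ p.2.2 ≤ n - (p.1 + p.2.1)}

/-- The triangle `S = conv {(n,0,0), (0,n,0), (0,0,-n)}`. -/
def lowerTriangle (n : ℕ) : Set (ℝ × ℝ × ℝ) :=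
  convexHull ℝ {((n : ℝ), 0, 0), (0, (n : ℝ), 0), (0, 0, -(n : ℝ))}

/-- The triangle `S' = conv {(n,0,0), (0,n,0), (0,0,n)}`. -/
def upperTriangle (n : ℕ) : Set (ℝ × ℝ × ℝ) :=
  convexHull ℝ {((n : ℝ), 0, 0), (0, (n : ℝ), 0), (0, 0, (n : ℝ))}

/-- The points of `D` that lie in the lattice `{(x, y, t) ∈ ℤ³ | x + y + t ≡ n mod 2}`.
The parity is the one for which the vertices of the two triangles are lattice points; for even `n`
the condition says that `x + y + t` is even. -/
def latticePoints (n : ℕ) (D : Set (ℝ × ℝ × ℝ)) : Set (ℤ × ℤ × ℤ) :=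
  {p | ((p.1 : ℝ), (p.2.1 : ℝ), (p.2.2 : ℝ)) ∈ D ∧ p.1 + p.2.1 + p.2.2 ≡ (n : ℤ) [ZMOD 2]}

/-- The set `H(D)` of states of `D`: the `F`-valued functions on the lattice points of `D`. -/
abbrev State (F : Type*) (n : ℕ) (D : Set (ℝ × ℝ × ℝ)) : Type _ := latticePoints n D → F

/-- `P H(D)`, the quotient of `H(D)` by the action of the multiplicative group of `F`
by (pointwise) scalar multiplication. -/
abbrev ProjState (F : Type*) [ZeroFreeSemifield F] (n : ℕ) (D : Set (ℝ × ℝ × ℝ)) : Type _ :=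
  MulAction.orbitRel.Quotient F (State F n D)

/-- The class of a state in `P H(D)`. -/
def projClass {F : Type*} [ZeroFreeSemifield F] {n : ℕ} {D : Set (ℝ × ℝ × ℝ)}
    (f : State F n D) : ProjState F n D :=
  Quotient.mk _ f

/-- The restriction of a state to a smaller domain. -/
def restrict {F : Type*} {n : ℕ} {D E : Set (ℝ × ℝ × ℝ)}
    (h : latticePoints n E ⊆ latticePoints n D) (g : State F n D) : State F n E :=
  fun p => g ⟨p, h p.2⟩

/-! ### The recurrence -/

/-- The bounded octahedron recurrence for a state `g` of a domain `D` in the space-time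
`Y = (ℝ_{≥0})² × ℝ`: there is one rule for the interior of the quadrant, one for each of its two
walls and one for its corner, imposed wherever all the points involved are lattice points of `D`. -/
structure SatisfiesRecurrence {F : Type*} [ZeroFreeSemifield F] {n : ℕ} {D : Set (ℝ × ℝ × ℝ)}
    (g : State F n D) : Prop where
  interior : ∀ (x y t : ℤ), 0 < x → 0 < y →
    ∀ (hu : (x, y, t + 1) ∈ latticePoints n D) (hd : (x, y, t - 1) ∈ latticePoints n D)
      (he : (x + 1, y, t) ∈ latticePoints n D) (hw : (x - 1, y, t) ∈ latticePoints n D)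
      (hn : (x, y + 1, t) ∈ latticePoints n D) (hs : (x, y - 1, t) ∈ latticePoints n D),
    g ⟨_, hu⟩ = (g ⟨_, he⟩ * g ⟨_, hw⟩ + g ⟨_, hn⟩ * g ⟨_, hs⟩) / g ⟨_, hd⟩
  wall_y : ∀ (x t : ℤ), 0 < x →
    ∀ (hu : (x, 0, t + 1) ∈ latticePoints n D) (hd : (x, 0, t - 1) ∈ latticePoints n D)
      (he : (x + 1, 0, t) ∈ latticePoints n D) (hw : (x - 1, 0, t) ∈ latticePoints n D),
    g ⟨_, hu⟩ = g ⟨_, he⟩ * g ⟨_, hw⟩ / g ⟨_, hd⟩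
  wall_x : ∀ (y t : ℤ), 0 < y →
    ∀ (hu : (0, y, t + 1) ∈ latticePoints n D) (hd : (0, y, t - 1) ∈ latticePoints n D)
      (hn : (0, y + 1, t) ∈ latticePoints n D) (hs : (0, y - 1, t) ∈ latticePoints n D),
    g ⟨_, hu⟩ = g ⟨_, hn⟩ * g ⟨_, hs⟩ / g ⟨_, hd⟩
  corner : ∀ (t : ℤ),
    ∀ (hu : (0, 0, t + 1) ∈ latticePoints n D) (hd : (0, 0, t - 1) ∈ latticePoints n D)
      (he : (1, 0, t) ∈ latticePoints n D) (hn : (0, 1, t) ∈ latticePoints n D),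
    g ⟨_, hu⟩ = g ⟨_, he⟩ * g ⟨_, hn⟩ / g ⟨_, hd⟩

/-! ### Lattice points of the three domains -/

theorem convex_comb_mem_convexHull {u v w : ℝ × ℝ × ℝ} {a b c : ℝ} (ha : 0 ≤ a) (hb : 0 ≤ b)
    (hc : 0 ≤ c) (h : a + b + c = 1) : a • u + b • v + c • w ∈ convexHull ℝ {u, v, w} := by
  have := (convex_convexHull ℝ ({u, v, w} : Set (ℝ × ℝ × ℝ))).sum_mem (t := Finset.univ)
    (w := ![a, b, c]) (z := ![u, v, w])
    (by intro i _; fin_cases i <;> simpa) (by simp [Fin.sum_univ_three, h])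
    (by intro i _; fin_cases i <;> exact subset_convexHull ℝ _ (by simp))
  simpa [Fin.sum_univ_three] using this

theorem mem_lowerTriangle {n : ℕ} {x y t : ℝ} :
    (x, y, t) ∈ lowerTriangle n ↔ 0 ≤ x ∧ 0 ≤ y ∧ t ≤ 0 ∧ t = x + y - n := by
  constructor
  · intro h
    have hconv : Convex ℝ {p : ℝ × ℝ × ℝ | 0 ≤ p.1 ∧ 0 ≤ p.2.1 ∧ p.2.2 ≤ 0 ∧
        p.2.2 = p.1 + p.2.1 - n} := by
      rintro ⟨x, y, t⟩ ⟨h1, h2, h3, h4⟩ ⟨x', y', t'⟩ ⟨h1', h2', h3', h4'⟩ a b ha hb hab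
      simp only [Set.mem_ofPred_eq, Prod.smul_mk, Prod.mk_add_mk, smul_eq_mul] at *
      refine ⟨by positivity, by positivity, ?_, ?_⟩
      · nlinarith
      · rw [h4, h4', eq_sub_of_add_eq hab]; ring
    refine convexHull_min ?_ hconv h
    rintro p (rfl | rfl | rfl) <;> simp
  · rintro ⟨hx, hy, ht, rfl⟩
    rcases Nat.eq_zero_or_pos n with rfl | hn
    · simp only [Nat.cast_zero, sub_zero] at ht ⊢
      obtain rfl : x = 0 := by linarith
      obtain rfl : y = 0 := by linarith
      exact subset_convexHull ℝ _ (by simp)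
    · have hn' : (0 : ℝ) < n := by exact_mod_cast hn
      have := convex_comb_mem_convexHull (u := ((n : ℝ), 0, 0)) (v := (0, (n : ℝ), 0))
        (w := (0, 0, -(n : ℝ))) (a := x / n) (b := y / n) (c := -(x + y - n) / n)
        (by positivity) (by positivity) (div_nonneg (by linarith) hn'.le) (by field_simp; ring)
      refine Set.mem_of_eq_of_mem ?_ this
      simp only [Prod.smul_mk, Prod.mk_add_mk, smul_eq_mul, Prod.mk.injEq]
      refine ⟨?_, ?_, ?_⟩ <;> field_simp <;> ring

theorem mem_upperTriangle {n : ℕ} {x y t : ℝ} :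
    (x, y, t) ∈ upperTriangle n ↔ 0 ≤ x ∧ 0 ≤ y ∧ 0 ≤ t ∧ t = n - (x + y) := by
  constructor
  · intro h
    have hconv : Convex ℝ {p : ℝ × ℝ × ℝ | 0 ≤ p.1 ∧ 0 ≤ p.2.1 ∧ 0 ≤ p.2.2 ∧
        p.2.2 = n - (p.1 + p.2.1)} := by
      rintro ⟨x, y, t⟩ ⟨h1, h2, h3, h4⟩ ⟨x', y', t'⟩ ⟨h1', h2', h3', h4'⟩ a b ha hb hab
      simp only [Set.mem_ofPred_eq, Prod.smul_mk, Prod.mk_add_mk, smul_eq_mul] at *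
      refine ⟨by positivity, by positivity, by positivity, ?_⟩
      rw [h4, h4', eq_sub_of_add_eq hab]; ring
    refine convexHull_min ?_ hconv h
    rintro p (rfl | rfl | rfl) <;> simp
  · rintro ⟨hx, hy, ht, rfl⟩
    rcases Nat.eq_zero_or_pos n with rfl | hn
    · simp only [Nat.cast_zero, zero_sub] at ht ⊢
      obtain rfl : x = 0 := by linarith
      obtain rfl : y = 0 := by linarith
      exact subset_convexHull ℝ _ (by simp)
    · have hn' : (0 : ℝ) < n := by exact_mod_cast hn
      have := convex_comb_mem_convexHull (u := ((n : ℝ), 0, 0)) (v := (0, (n : ℝ), 0))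
        (w := (0, 0, (n : ℝ))) (a := x / n) (b := y / n) (c := (n - (x + y)) / n)
        (by positivity) (by positivity) (div_nonneg (by linarith) hn'.le) (by field_simp; ring)
      refine Set.mem_of_eq_of_mem ?_ this
      simp only [Prod.smul_mk, Prod.mk_add_mk, smul_eq_mul, Prod.mk.injEq]
      refine ⟨?_, ?_, ?_⟩ <;> field_simp <;> ring

theorem mem_latticePoints_quarter {n : ℕ} {x y t : ℤ} :
    (x, y, t) ∈ latticePoints n (quarterOctahedron n) ↔
      0 ≤ x ∧ 0 ≤ y ∧ x + y - n ≤ t ∧ t ≤ n - (x + y) ∧ (x + y + t - n) % 2 = 0 := by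
  simp only [latticePoints, quarterOctahedron, spaceTime, Set.mem_ofPred_eq, Int.ModEq]
  norm_cast
  omega

theorem mem_latticePoints_lower {n : ℕ} {x y t : ℤ} :
    (x, y, t) ∈ latticePoints n (lowerTriangle n) ↔
      0 ≤ x ∧ 0 ≤ y ∧ x + y ≤ n ∧ t = x + y - n := by
  simp only [latticePoints, Set.mem_ofPred_eq, Int.ModEq, mem_lowerTriangle]
  norm_cast
  omega

theorem mem_latticePoints_upper {n : ℕ} {x y t : ℤ} :
    (x, y, t) ∈ latticePoints n (upperTriangle n) ↔
      0 ≤ x ∧ 0 ≤ y ∧ x + y ≤ n ∧ t = n - (x + y) := by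
  simp only [latticePoints, Set.mem_ofPred_eq, Int.ModEq, mem_upperTriangle]
  norm_cast
  omega

theorem lower_subset (n : ℕ) :
    latticePoints n (lowerTriangle n) ⊆ latticePoints n (quarterOctahedron n) := by
  rintro ⟨x, y, t⟩ h
  rw [mem_latticePoints_lower] at h
  rw [mem_latticePoints_quarter]
  omega

theorem upper_subset (n : ℕ) :
    latticePoints n (upperTriangle n) ⊆ latticePoints n (quarterOctahedron n) := by
  rintro ⟨x, y, t⟩ h
  rw [mem_latticePoints_upper] at h
  rw [mem_latticePoints_quarter]
  omega

/-! ### A state of the lower triangle extends uniquely to the quarter-octahedron -/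

/-- Auxiliary recursion on natural number coordinates: the value at `(x, y, x + y - n + 2 k)`,
in terms of the initial values `s x y` (those for `k = 0`). -/
def evolve {F : Type*} [ZeroFreeSemifield F] (s : ℕ → ℕ → F) : ℕ → ℕ → ℕ → F
  | 0, x, y => s x y
  | k + 1, 0, 0 => evolve s k 1 0 * evolve s k 0 1 / evolve s k 0 0
  | k + 1, x + 1, 0 => evolve s k (x + 2) 0 * evolve s (k + 1) x 0 / evolve s k (x + 1) 0
  | k + 1, 0, y + 1 => evolve s k 0 (y + 2) * evolve s (k + 1) 0 y / evolve s k 0 (y + 1)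
  | k + 1, x + 1, y + 1 =>
      (evolve s k (x + 2) (y + 1) * evolve s (k + 1) x (y + 1) +
        evolve s k (x + 1) (y + 2) * evolve s (k + 1) (x + 1) y) / evolve s k (x + 1) (y + 1)
termination_by k x y => (k, x + y)

open Classical in
/-- The values of a state of the lower triangle, on natural number coordinates. -/
def seed {F : Type*} [ZeroFreeSemifield F] {n : ℕ} (f : State F n (lowerTriangle n))
    (x y : ℕ) : F :=
  if h : ((x : ℤ), (y : ℤ), (x : ℤ) + y - n) ∈ latticePoints n (lowerTriangle n) then f ⟨_, h⟩
  else 1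

/-- The state of the quarter-octahedron obtained from a state of the lower triangle. -/
def evolved {F : Type*} [ZeroFreeSemifield F] {n : ℕ} (f : State F n (lowerTriangle n)) :
    State F n (quarterOctahedron n) :=
  fun p => evolve (seed f) ((p.1.2.2 - (p.1.1 + p.1.2.1 - n)) / 2).toNat p.1.1.toNat p.1.2.1.toNat

theorem evolved_apply {F : Type*} [ZeroFreeSemifield F] {n : ℕ} (f : State F n (lowerTriangle n))
    (p : latticePoints n (quarterOctahedron n)) (k x y : ℕ)
    (h : p.1 = ((x : ℤ), (y : ℤ), (x : ℤ) + y - n + 2 * k)) :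
    evolved f p = evolve (seed f) k x y := by
  simp only [evolved, h]
  congr 1
  omega

theorem exists_coords {n : ℕ} {x y t : ℤ} (h : (x, y, t) ∈ latticePoints n (quarterOctahedron n)) :
    ∃ k a b : ℕ, x = a ∧ y = b ∧ t = (a : ℤ) + b - n + 2 * k := by
  rw [mem_latticePoints_quarter] at h
  exact ⟨((t - (x + y - n)) / 2).toNat, x.toNat, y.toNat, by omega, by omega, by omega⟩

theorem evolved_satisfies {F : Type*} [ZeroFreeSemifield F] {n : ℕ}
    (f : State F n (lowerTriangle n)) : SatisfiesRecurrence (evolved f) := by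
  refine ⟨?_, ?_, ?_, ?_⟩
  · intro x y t hx hy hu hd he hw hn hs
    obtain ⟨k, a, b, rfl, rfl, ht⟩ := exists_coords hd
    obtain ⟨a, rfl⟩ := Nat.exists_eq_succ_of_ne_zero (show a ≠ 0 by omega)
    obtain ⟨b, rfl⟩ := Nat.exists_eq_succ_of_ne_zero (show b ≠ 0 by omega)
    obtain rfl : t = (a : ℤ) + 1 + (b + 1) - n + 2 * k + 1 := by push_cast at ht; linarith
    rw [evolved_apply f ⟨_, hu⟩ (k + 1) (a + 1) (b + 1) (by ext <;> push_cast <;> ring),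
      evolved_apply f ⟨_, hd⟩ k (a + 1) (b + 1) (by ext <;> push_cast <;> ring),
      evolved_apply f ⟨_, he⟩ k (a + 2) (b + 1) (by ext <;> push_cast <;> ring),
      evolved_apply f ⟨_, hw⟩ (k + 1) a (b + 1) (by ext <;> push_cast <;> ring),
      evolved_apply f ⟨_, hn⟩ k (a + 1) (b + 2) (by ext <;> push_cast <;> ring),
      evolved_apply f ⟨_, hs⟩ (k + 1) (a + 1) b (by ext <;> push_cast <;> ring), evolve]
  · intro x t hx hu hd he hw
    obtain ⟨k, a, b, rfl, hb, ht⟩ := exists_coords hd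
    obtain ⟨a, rfl⟩ := Nat.exists_eq_succ_of_ne_zero (show a ≠ 0 by omega)
    obtain rfl : t = (a : ℤ) + 1 - n + 2 * k + 1 := by push_cast at ht; linarith
    rw [evolved_apply f ⟨_, hu⟩ (k + 1) (a + 1) 0 (by ext <;> push_cast <;> ring),
      evolved_apply f ⟨_, hd⟩ k (a + 1) 0 (by ext <;> push_cast <;> ring),
      evolved_apply f ⟨_, he⟩ k (a + 2) 0 (by ext <;> push_cast <;> ring),
      evolved_apply f ⟨_, hw⟩ (k + 1) a 0 (by ext <;> push_cast <;> ring), evolve]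
  · intro y t hy hu hd hn hs
    obtain ⟨k, a, b, ha, rfl, ht⟩ := exists_coords hd
    obtain ⟨b, rfl⟩ := Nat.exists_eq_succ_of_ne_zero (show b ≠ 0 by omega)
    obtain rfl : t = (b : ℤ) + 1 - n + 2 * k + 1 := by push_cast at ht; linarith
    rw [evolved_apply f ⟨_, hu⟩ (k + 1) 0 (b + 1) (by ext <;> push_cast <;> ring),
      evolved_apply f ⟨_, hd⟩ k 0 (b + 1) (by ext <;> push_cast <;> ring),
      evolved_apply f ⟨_, hn⟩ k 0 (b + 2) (by ext <;> push_cast <;> ring),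
      evolved_apply f ⟨_, hs⟩ (k + 1) 0 b (by ext <;> push_cast <;> ring), evolve]
  · intro t hu hd he hn
    obtain ⟨k, a, b, ha, hb, ht⟩ := exists_coords hd
    obtain rfl : t = -(n : ℤ) + 2 * k + 1 := by linarith
    rw [evolved_apply f ⟨_, hu⟩ (k + 1) 0 0 (by ext <;> push_cast <;> ring),
      evolved_apply f ⟨_, hd⟩ k 0 0 (by ext <;> push_cast <;> ring),
      evolved_apply f ⟨_, he⟩ k 1 0 (by ext <;> push_cast <;> ring),
      evolved_apply f ⟨_, hn⟩ k 0 1 (by ext <;> push_cast <;> ring), evolve]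

theorem restrict_evolved {F : Type*} [ZeroFreeSemifield F] {n : ℕ}
    (f : State F n (lowerTriangle n)) : restrict (lower_subset n) (evolved f) = f := by
  funext ⟨⟨x, y, t⟩, h⟩
  have h' := mem_latticePoints_lower.1 h
  obtain ⟨a, rfl⟩ := Int.eq_ofNat_of_zero_le h'.1
  obtain ⟨b, rfl⟩ := Int.eq_ofNat_of_zero_le h'.2.1
  obtain rfl : t = (a : ℤ) + b - n := h'.2.2.2
  rw [restrict, evolved_apply f _ 0 a b (by simp), evolve, seed, dif_pos h]

theorem eq_evolve_of_satisfies {F : Type*} [ZeroFreeSemifield F] {n : ℕ}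
    {g : State F n (quarterOctahedron n)} (hg : SatisfiesRecurrence g) (k x y : ℕ)
    (h : ((x : ℤ), (y : ℤ), (x : ℤ) + y - n + 2 * k) ∈ latticePoints n (quarterOctahedron n)) :
    g ⟨_, h⟩ = evolve (seed (restrict (lower_subset n) g)) k x y := by
  have key : ∀ (k x y : ℕ) (p : latticePoints n (quarterOctahedron n)),
      p.1 = ((x : ℤ), (y : ℤ), (x : ℤ) + y - n + 2 * k) →
      g p = evolve (seed (restrict (lower_subset n) g)) k x y := by
    clear h k x y
    intro k
    induction k with
    | zero =>
      rintro x y ⟨p, hp⟩ h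
      simp only [Nat.cast_zero, mul_zero, add_zero] at h
      subst h
      have hm : ((x : ℤ), (y : ℤ), (x : ℤ) + y - n) ∈ latticePoints n (lowerTriangle n) := by
        rw [mem_latticePoints_quarter] at hp
        rw [mem_latticePoints_lower]
        omega
      rw [evolve, seed, dif_pos hm]
      rfl
    | succ k ih =>
      intro x y
      induction hN : x + y using Nat.strong_induction_on generalizing x y with
      | _ N ih2 =>
      rintro ⟨⟨a, b, t⟩, hp⟩ h
      obtain ⟨t, rfl⟩ : ∃ s, t = s + 1 := ⟨t - 1, by ring⟩
      simp only [Prod.mk.injEq] at h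
      obtain ⟨h1, h2, h3⟩ := h
      have hq := mem_latticePoints_quarter.1 hp
      rcases x with _ | x <;> rcases y with _ | y
      · obtain rfl : a = 0 := by omega
        obtain rfl : b = 0 := by omega
        have hd : ((0 : ℤ), (0 : ℤ), t - 1) ∈ latticePoints n (quarterOctahedron n) := by
          rw [mem_latticePoints_quarter]; omega
        have he : ((1 : ℤ), (0 : ℤ), t) ∈ latticePoints n (quarterOctahedron n) := by
          rw [mem_latticePoints_quarter]; omega
        have hn : ((0 : ℤ), (1 : ℤ), t) ∈ latticePoints n (quarterOctahedron n) := by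
          rw [mem_latticePoints_quarter]; omega
        rw [hg.corner _ hp hd he hn, ih 0 0 ⟨_, hd⟩ (by simp only [Prod.mk.injEq]; omega),
          ih 1 0 ⟨_, he⟩ (by simp only [Prod.mk.injEq]; omega),
          ih 0 1 ⟨_, hn⟩ (by simp only [Prod.mk.injEq]; omega), evolve]
      · obtain rfl : a = 0 := by omega
        have hd : ((0 : ℤ), b, t - 1) ∈ latticePoints n (quarterOctahedron n) := by
          rw [mem_latticePoints_quarter]; omega
        have hn : ((0 : ℤ), b + 1, t) ∈ latticePoints n (quarterOctahedron n) := by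
          rw [mem_latticePoints_quarter]; omega
        have hs : ((0 : ℤ), b - 1, t) ∈ latticePoints n (quarterOctahedron n) := by
          rw [mem_latticePoints_quarter]; omega
        rw [hg.wall_x _ _ (by omega) hp hd hn hs,
          ih 0 (y + 1) ⟨_, hd⟩ (by simp only [Prod.mk.injEq]; omega),
          ih 0 (y + 2) ⟨_, hn⟩ (by simp only [Prod.mk.injEq]; omega),
          ih2 (0 + y) (by omega) 0 y rfl ⟨_, hs⟩ (by simp only [Prod.mk.injEq]; omega), evolve]
      · obtain rfl : b = 0 := by omega
        have hd : (a, (0 : ℤ), t - 1) ∈ latticePoints n (quarterOctahedron n) := by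
          rw [mem_latticePoints_quarter]; omega
        have he : (a + 1, (0 : ℤ), t) ∈ latticePoints n (quarterOctahedron n) := by
          rw [mem_latticePoints_quarter]; omega
        have hw : (a - 1, (0 : ℤ), t) ∈ latticePoints n (quarterOctahedron n) := by
          rw [mem_latticePoints_quarter]; omega
        rw [hg.wall_y _ _ (by omega) hp hd he hw,
          ih (x + 1) 0 ⟨_, hd⟩ (by simp only [Prod.mk.injEq]; omega),
          ih (x + 2) 0 ⟨_, he⟩ (by simp only [Prod.mk.injEq]; omega),
          ih2 (x + 0) (by omega) x 0 rfl ⟨_, hw⟩ (by simp only [Prod.mk.injEq]; omega), evolve]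
      · have hd : (a, b, t - 1) ∈ latticePoints n (quarterOctahedron n) := by
          rw [mem_latticePoints_quarter]; omega
        have he : (a + 1, b, t) ∈ latticePoints n (quarterOctahedron n) := by
          rw [mem_latticePoints_quarter]; omega
        have hw : (a - 1, b, t) ∈ latticePoints n (quarterOctahedron n) := by
          rw [mem_latticePoints_quarter]; omega
        have hn : (a, b + 1, t) ∈ latticePoints n (quarterOctahedron n) := by
          rw [mem_latticePoints_quarter]; omega
        have hs : (a, b - 1, t) ∈ latticePoints n (quarterOctahedron n) := by
          rw [mem_latticePoints_quarter]; omega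
        rw [hg.interior _ _ _ (by omega) (by omega) hp hd he hw hn hs,
          ih (x + 1) (y + 1) ⟨_, hd⟩ (by simp only [Prod.mk.injEq]; omega),
          ih (x + 2) (y + 1) ⟨_, he⟩ (by simp only [Prod.mk.injEq]; omega),
          ih (x + 1) (y + 2) ⟨_, hn⟩ (by simp only [Prod.mk.injEq]; omega),
          ih2 (x + (y + 1)) (by omega) x (y + 1) rfl ⟨_, hw⟩
            (by simp only [Prod.mk.injEq]; omega),
          ih2 (x + 1 + y) (by omega) (x + 1) y rfl ⟨_, hs⟩
            (by simp only [Prod.mk.injEq]; omega), evolve]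
  exact key k x y ⟨_, h⟩ rfl

theorem existsUnique_extension {F : Type*} [ZeroFreeSemifield F] {n : ℕ}
    (f : State F n (lowerTriangle n)) :
    ∃! g : State F n (quarterOctahedron n),
      SatisfiesRecurrence g ∧ restrict (lower_subset n) g = f := by
  refine ⟨evolved f, ⟨evolved_satisfies f, restrict_evolved f⟩, ?_⟩
  rintro g ⟨hg, rfl⟩
  funext ⟨⟨x, y, t⟩, h⟩
  obtain ⟨k, a, b, rfl, rfl, rfl⟩ := exists_coords h
  rw [eq_evolve_of_satisfies hg, evolved_apply _ _ k a b rfl]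

/-! ### The maps `φ` and `φ̄` -/

/-- The unique state of the quarter-octahedron that satisfies the bounded octahedron recurrence
and extends the state `f` of the lower triangle. -/
def extend {F : Type*} [ZeroFreeSemifield F] {n : ℕ} (f : State F n (lowerTriangle n)) :
    State F n (quarterOctahedron n) :=
  (existsUnique_extension f).choose

theorem extend_spec {F : Type*} [ZeroFreeSemifield F] {n : ℕ} (f : State F n (lowerTriangle n)) :
    SatisfiesRecurrence (extend f) ∧ restrict (lower_subset n) (extend f) = f :=
  (existsUnique_extension f).choose_spec.1

theorem eq_extend {F : Type*} [ZeroFreeSemifield F] {n : ℕ} {f : State F n (lowerTriangle n)}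
    {g : State F n (quarterOctahedron n)} (hg : SatisfiesRecurrence g)
    (h : restrict (lower_subset n) g = f) : g = extend f :=
  (existsUnique_extension f).choose_spec.2 g ⟨hg, h⟩

/-- The map `φ : H(S) → H(S')` defined by the bounded octahedron recurrence on `A`. -/
def phi {F : Type*} [ZeroFreeSemifield F] {n : ℕ} (f : State F n (lowerTriangle n)) :
    State F n (upperTriangle n) :=
  restrict (upper_subset n) (extend f)

theorem smul_mul_smul_div {F : Type*} [ZeroFreeSemifield F] (c a b d : F) :
    c * a * (c * b) / (c * d) = c * (a * b / d) := by
  rw [div_eq_iff_eq_mul]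
  calc c * a * (c * b) = c * (c * (a * b)) := by
        rw [mul_mul_mul_comm, mul_assoc]
    _ = c * (a * b / d) * (c * d) := by
        rw [mul_mul_mul_comm, div_mul_cancel, mul_assoc]

theorem SatisfiesRecurrence.smul {F : Type*} [ZeroFreeSemifield F] {n : ℕ}
    {D : Set (ℝ × ℝ × ℝ)} {g : State F n D} (hg : SatisfiesRecurrence g) (c : F) :
    SatisfiesRecurrence (c • g) := by
  refine ⟨?_, ?_, ?_, ?_⟩
  · intro x y t hx hy hu hd he hw hn hs
    simp only [Pi.smul_apply, smul_eq_mul, hg.interior x y t hx hy hu hd he hw hn hs]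
    have h1 (a b : F) : c * a * (c * b) = c * (c * (a * b)) := by
      rw [mul_mul_mul_comm, mul_assoc]
    rw [h1, h1, ← mul_add, ← mul_add, mul_div_mul_left_eq_div, mul_div_assoc]
  · intro x t hx hu hd he hw
    simp only [Pi.smul_apply, smul_eq_mul, hg.wall_y x t hx hu hd he hw, smul_mul_smul_div]
  · intro y t hy hu hd hn hs
    simp only [Pi.smul_apply, smul_eq_mul, hg.wall_x y t hy hu hd hn hs, smul_mul_smul_div]
  · intro t hu hd he hn
    simp only [Pi.smul_apply, smul_eq_mul, hg.corner t hu hd he hn, smul_mul_smul_div]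

theorem phi_smul {F : Type*} [ZeroFreeSemifield F] {n : ℕ} (c : F)
    (f : State F n (lowerTriangle n)) : phi (c • f) = c • phi f := by
  have h := extend_spec f
  have : c • extend f = extend (c • f) := by
    refine eq_extend (h.1.smul c) ?_
    conv_rhs => rw [← h.2]
    rfl
  rw [phi, ← this]
  rfl

/-- The map `φ̄ : P H(S) → P H(S')` induced by `φ`. -/
def phiBar {F : Type*} [ZeroFreeSemifield F] {n : ℕ} :
    ProjState F n (lowerTriangle n) → ProjState F n (upperTriangle n) :=
  Quotient.map phi (by
    rintro _ f ⟨c, rfl⟩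
    exact ⟨c, (phi_smul c f).symm⟩)

/-! ### The rotations and their pullbacks -/

/-- The linear map whose restriction to `S` is the rotation
`r : (n,0,0) ↦ (0,n,0) ↦ (0,0,-n) ↦ (n,0,0)`. -/
def rotLower : (ℝ × ℝ × ℝ) →ₗ[ℝ] (ℝ × ℝ × ℝ) where
  toFun p := (-p.2.2, p.1, -p.2.1)
  map_add' p q := by ext <;> simp <;> ring
  map_smul' c p := by ext <;> simp

/-- The linear map whose restriction to `S'` is the rotation
`r' : (n,0,0) ↦ (0,0,n) ↦ (0,n,0) ↦ (n,0,0)`. -/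
def rotUpper : (ℝ × ℝ × ℝ) →ₗ[ℝ] (ℝ × ℝ × ℝ) where
  toFun p := (p.2.1, p.2.2, p.1)
  map_add' _ _ := rfl
  map_smul' _ _ := rfl

theorem rotLower_vertices (n : ℕ) :
    rotLower ((n : ℝ), 0, 0) = (0, (n : ℝ), 0) ∧ rotLower (0, (n : ℝ), 0) = (0, 0, -(n : ℝ)) ∧
      rotLower (0, 0, -(n : ℝ)) = ((n : ℝ), 0, 0) := by
  simp [rotLower]

theorem rotUpper_vertices (n : ℕ) :
    rotUpper ((n : ℝ), 0, 0) = (0, 0, (n : ℝ)) ∧ rotUpper (0, 0, (n : ℝ)) = (0, (n : ℝ), 0) ∧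
      rotUpper (0, (n : ℝ), 0) = ((n : ℝ), 0, 0) := by
  simp [rotUpper]

/-- The rotation `r` on the lattice points of `S`. -/
def r {n : ℕ} (p : latticePoints n (lowerTriangle n)) : latticePoints n (lowerTriangle n) :=
  ⟨(-p.1.2.2, p.1.1, -p.1.2.1), by
    obtain ⟨⟨x, y, t⟩, hp⟩ := p
    rw [mem_latticePoints_lower] at hp ⊢
    simp only
    omega⟩

/-- The rotation `r'` on the lattice points of `S'`. -/
def r' {n : ℕ} (p : latticePoints n (upperTriangle n)) : latticePoints n (upperTriangle n) :=
  ⟨(p.1.2.1, p.1.2.2, p.1.1), by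
    obtain ⟨⟨x, y, t⟩, hp⟩ := p
    rw [mem_latticePoints_upper] at hp ⊢
    simp only
    omega⟩

theorem coe_r {n : ℕ} (p : latticePoints n (lowerTriangle n)) :
    (((r p).1.1 : ℝ), ((r p).1.2.1 : ℝ), ((r p).1.2.2 : ℝ)) =
      rotLower ((p.1.1 : ℝ), (p.1.2.1 : ℝ), (p.1.2.2 : ℝ)) := by
  simp [r, rotLower]

theorem coe_r' {n : ℕ} (p : latticePoints n (upperTriangle n)) :
    (((r' p).1.1 : ℝ), ((r' p).1.2.1 : ℝ), ((r' p).1.2.2 : ℝ)) =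
      rotUpper ((p.1.1 : ℝ), (p.1.2.1 : ℝ), (p.1.2.2 : ℝ)) := by
  simp [r', rotUpper]

/-- The pullback of projectivized states along a self-map `ρ` of the lattice points of `D`:
the class of `f` is sent to the class of `f ∘ ρ`. -/
def pullback {F : Type*} [ZeroFreeSemifield F] {n : ℕ} {D : Set (ℝ × ℝ × ℝ)}
    (ρ : latticePoints n D → latticePoints n D) : ProjState F n D → ProjState F n D :=
  Quotient.map (fun f => f ∘ ρ) (by
    rintro _ f ⟨c, rfl⟩
    exact ⟨c, rfl⟩)

end Octahedron

end

/-!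
Let `T_g` be the evolution of the seed `(a, b) ↦ s (g + a) b`, multiplied by `s g 0` and extended
by zero beyond the walls and below the initial layer. As a function of `(k, x, y, g)` it satisfies
the octahedron relations of all five `A₃`-sublattices of the `A₄`-lattice: five neighbouring
relations are the three-term Plücker relations of a pentagon, where suitable triples imply the
other two, so they propagate from the initial layer and the walls. One of these relations says that
`(k, x, y) ↦ T_{n-k-x-y} (x, y, k)` again satisfies the bounded recurrence. Its initial values
are those of the rotated state, up to the normalization, so it is the evolution of that state.

Bijectivity is time reversal: `φ` followed by the reflection `t ↦ -t` is an involution.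
-/

namespace Octahedron

section Bilinear

variable {K : Type*} [CommSemiring K]

theorem plucker_of_plucker [IsCancelMulZero K]
    {p₁₂ p₁₃ p₁₄ p₁₅ p₂₃ p₂₄ p₂₅ p₃₄ p₃₅ p₄₅ : K} (h₁₃ : p₁₃ ≠ 0)
    (h₁₂₃₄ : p₁₃ * p₂₄ = p₁₂ * p₃₄ + p₁₄ * p₂₃) (h₁₂₃₅ : p₁₃ * p₂₅ = p₁₂ * p₃₅ + p₁₅ * p₂₃)
    (h₁₃₄₅ : p₁₄ * p₃₅ = p₁₃ * p₄₅ + p₁₅ * p₃₄) :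
    p₁₄ * p₂₅ = p₁₂ * p₄₅ + p₁₅ * p₂₄ ∧ p₂₄ * p₃₅ = p₂₃ * p₄₅ + p₂₅ * p₃₄ := by
  constructor <;> refine mul_left_cancel₀ h₁₃ ?_
  · calc p₁₃ * (p₁₄ * p₂₅) = p₁₄ * (p₁₃ * p₂₅) := by ring
      _ = p₁₂ * (p₁₄ * p₃₅) + p₁₅ * (p₁₄ * p₂₃) := by rw [h₁₂₃₅]; ring
      _ = p₁₃ * (p₁₂ * p₄₅) + p₁₅ * (p₁₂ * p₃₄ + p₁₄ * p₂₃) := by rw [h₁₃₄₅]; ring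
      _ = p₁₃ * (p₁₂ * p₄₅ + p₁₅ * p₂₄) := by rw [← h₁₂₃₄]; ring
  · calc p₁₃ * (p₂₄ * p₃₅) = p₁₃ * p₂₄ * p₃₅ := by ring
      _ = p₂₃ * (p₁₄ * p₃₅) + p₃₄ * (p₁₂ * p₃₅) := by rw [h₁₂₃₄]; ring
      _ = p₁₃ * (p₂₃ * p₄₅) + p₃₄ * (p₁₂ * p₃₅ + p₁₅ * p₂₃) := by rw [h₁₃₄₅]; ring
      _ = p₁₃ * (p₂₃ * p₄₅ + p₂₅ * p₃₄) := by rw [← h₁₂₃₅]; ring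

/-- A solution of the bounded octahedron recurrence on the coordinates `(k, x, y)` of `evolve`.
Each index is shifted by one, and `T` vanishes where an index is `0`; the missing terms at the walls
are thus zero, and only the corner needs a rule of its own. -/
structure IsPaddedSolution (T : ℕ → ℕ → ℕ → K) : Prop where
  time_zero : ∀ x y, T 0 x y = 0
  x_zero : ∀ k y, T k 0 y = 0
  y_zero : ∀ k x, T k x 0 = 0
  ne_zero : ∀ k x y, T (k + 1) (x + 1) (y + 1) ≠ 0
  recurrence : ∀ k x y, x + y ≠ 0 → T (k + 1) (x + 1) (y + 1) * T (k + 2) (x + 1) (y + 1) =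
    T (k + 1) (x + 2) (y + 1) * T (k + 2) x (y + 1) +
      T (k + 1) (x + 1) (y + 2) * T (k + 2) (x + 1) y
  corner : ∀ k, T (k + 1) 1 1 * T (k + 2) 1 1 = T (k + 1) 2 1 * T (k + 1) 1 2

/-- The octahedron relation between two neighbouring slices `T = T_g` and `U = T_{g+1}` that
expresses the recurrence in `y` (with the roles of `(k, x, y)` rotated). -/
def CrossRecurrence (T U : ℕ → ℕ → ℕ → K) (k x y : ℕ) : Prop :=
  T (k + 1) (x + 1) (y + 1) * U (k + 1) (x + 1) y =
    T (k + 1) (x + 2) y * U (k + 1) x (y + 1) + U k (x + 1) (y + 1) * T (k + 2) (x + 1) y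

/-- A second octahedron relation between neighbouring slices `T = T_g` and `U = T_{g+1}`, through
which `CrossRecurrence` propagates from one value of `k` to the next. -/
def SideRecurrence (T U : ℕ → ℕ → ℕ → K) (k x y : ℕ) : Prop :=
  T (k + 2) (x + 1) (y + 1) * U (k + 1) x (y + 1) =
    T (k + 2) (x + 1) y * U (k + 1) x (y + 2) + U (k + 1) (x + 1) (y + 1) * T (k + 2) x (y + 1)

namespace IsPaddedSolution

variable {T U : ℕ → ℕ → ℕ → K}

theorem swap (hT : IsPaddedSolution T) : IsPaddedSolution fun k x y => T k y x where
  time_zero x y := hT.time_zero y x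
  x_zero := hT.y_zero
  y_zero := hT.x_zero
  ne_zero k x y := hT.ne_zero k y x
  recurrence k x y hxy := by rw [hT.recurrence k y x (by omega), add_comm]
  corner k := by rw [hT.corner, mul_comm]

theorem sideRecurrence_x_zero (hT : IsPaddedSolution T) (hU : IsPaddedSolution U) (k y : ℕ) :
    SideRecurrence T U k 0 y := by
  simp only [SideRecurrence, hT.x_zero, hU.x_zero, mul_zero, add_zero]

theorem crossRecurrence_y_zero (hT : IsPaddedSolution T) (hU : IsPaddedSolution U) (k x : ℕ) :
    CrossRecurrence T U k x 0 := by
  simp only [CrossRecurrence, hT.y_zero, hU.y_zero, mul_zero, zero_mul, add_zero]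

variable {c : K}

theorem crossRecurrence_zero (hU : IsPaddedSolution U)
    (hc : ∀ x y, U 1 (x + 1) y = c * T 1 (x + 2) y) (x y : ℕ) :
    CrossRecurrence T U 0 (x + 1) y := by
  simp only [CrossRecurrence, zero_add, hc, hU.time_zero]
  ring

theorem sideRecurrence_zero (hT : IsPaddedSolution T) (hU : IsPaddedSolution U)
    (hc : ∀ x y, U 1 (x + 1) y = c * T 1 (x + 2) y) : ∀ x y : ℕ, SideRecurrence T U 0 x y
  | 0, y => sideRecurrence_x_zero hT hU 0 y
  | x + 1, y => by
    calc T 2 (x + 2) (y + 1) * U 1 (x + 1) (y + 1)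
        = c * (T 1 (x + 2) (y + 1) * T 2 (x + 2) (y + 1)) := by rw [hc]; ring
      _ = T 2 (x + 2) y * U 1 (x + 1) (y + 2) + U 1 (x + 2) (y + 1) * T 2 (x + 1) (y + 1) := by
        rw [hT.recurrence 0 (x + 1) y (by omega), hc, hc]; ring

variable [IsCancelMulZero K]

theorem mul_wall_y (hT : IsPaddedSolution T) (k x : ℕ) :
    T 1 1 1 * T (k + 1) (x + 1) 1 = T 1 (x + k + 1) 1 * T 1 1 (k + 1) := by
  induction k generalizing T x with
  | zero => exact mul_comm _ _
  | succ k ih =>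
    induction x with
    | zero =>
      refine mul_left_cancel₀ (mul_ne_zero (hT.ne_zero 0 0 0) (hT.ne_zero k 0 0)) ?_
      calc T 1 1 1 * T (k + 1) 1 1 * (T 1 1 1 * T (k + 2) 1 1)
          = T 1 1 1 * T 1 1 1 * (T (k + 1) 1 1 * T (k + 2) 1 1) := by ring
        _ = (T 1 1 1 * T (k + 1) 2 1) * (T 1 1 1 * T (k + 1) 1 2) := by rw [hT.corner]; ring
        _ = (T 1 (k + 1) 1 * T 1 1 (k + 1)) * (T 1 (k + 2) 1 * T 1 1 (k + 2)) := by
          rw [ih hT 1, ih hT.swap 1, add_comm 1 k]; ring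
        _ = T 1 1 1 * T (k + 1) 1 1 * (T 1 (0 + (k + 1) + 1) 1 * T 1 1 (k + 1 + 1)) := by
          rw [ih hT 0]; simp only [zero_add, add_assoc, Nat.reduceAdd]
    | succ x ihx =>
      have hrec := hT.recurrence k (x + 1) 0 (by omega)
      rw [hT.y_zero, mul_zero, add_zero] at hrec
      refine mul_left_cancel₀ (mul_ne_zero (hT.ne_zero 0 0 0) (hT.ne_zero k (x + 1) 0)) ?_
      calc T 1 1 1 * T (k + 1) (x + 2) 1 * (T 1 1 1 * T (k + 2) (x + 2) 1)
          = T 1 1 1 * T 1 1 1 * (T (k + 1) (x + 2) 1 * T (k + 2) (x + 2) 1) := by ring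
        _ = (T 1 1 1 * T (k + 1) (x + 3) 1) * (T 1 1 1 * T (k + 2) (x + 1) 1) := by
          rw [hrec]; ring
        _ = T 1 1 1 * T (k + 1) (x + 2) 1 * (T 1 (x + 1 + (k + 1) + 1) 1 * T 1 1 (k + 2)) := by
          rw [ihx, ih hT (x + 1), ih hT (x + 2), show x + 2 + k = x + 1 + (k + 1) by omega,
            show x + (k + 1) = x + 1 + k by omega]
          ring

theorem mul_wall_x (hT : IsPaddedSolution T) (k y : ℕ) :
    T 1 1 1 * T (k + 1) 1 (y + 1) = T 1 1 (y + k + 1) * T 1 (k + 1) 1 :=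
  hT.swap.mul_wall_y k y

theorem crossRecurrence_x_zero (hT : IsPaddedSolution T) (hU : IsPaddedSolution U)
    (hc : ∀ x y, U 1 (x + 1) y = c * T 1 (x + 2) y) (k : ℕ) :
    ∀ y, CrossRecurrence T U (k + 1) 0 y
  | 0 => crossRecurrence_y_zero hT hU (k + 1) 0
  | y + 1 => by
    simp only [CrossRecurrence, hU.x_zero, mul_zero, zero_add]
    refine mul_left_cancel₀ (mul_ne_zero (hT.ne_zero 0 0 0) (hU.ne_zero 0 0 0)) ?_
    calc T 1 1 1 * U 1 1 1 * (T (k + 2) 1 (y + 2) * U (k + 2) 1 (y + 1))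
        = (T 1 1 1 * T (k + 2) 1 (y + 2)) * (U 1 1 1 * U (k + 2) 1 (y + 1)) := by ring
      _ = (T 1 1 1 * T (k + 3) 1 (y + 1)) * (U 1 1 1 * U (k + 1) 1 (y + 2)) := by
        rw [hT.mul_wall_x (k + 1) (y + 1), hT.mul_wall_x (k + 2) y, hU.mul_wall_x (k + 1) y,
          hU.mul_wall_x k (y + 1), hc (k + 1) 1, hc k 1,
          show y + 1 + (k + 1) = y + (k + 2) by omega, show y + 1 + k = y + (k + 1) by omega]
        ring
      _ = T 1 1 1 * U 1 1 1 * (U (k + 1) 1 (y + 2) * T (k + 3) 1 (y + 1)) := by ring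

theorem crossRecurrence_and_sideRecurrence (hT : IsPaddedSolution T) (hU : IsPaddedSolution U)
    {k x y : ℕ} (hside : SideRecurrence T U k (x + 2) y)
    (hside' : SideRecurrence T U k (x + 1) (y + 1))
    (hcross : CrossRecurrence T U (k + 1) (x + 1) y)
    (hcross' : CrossRecurrence T U (k + 1) x (y + 1)) :
    CrossRecurrence T U (k + 1) (x + 1) (y + 1) ∧ SideRecurrence T U (k + 1) (x + 1) y := by
  -- Two pentagons containing the recurrence of `U` give the relations of the two remaining
  -- `A₃`-directions; a third pentagon, containing the recurrence of `T`, gives the claim.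
  have hdiag : T (k + 2) (x + 2) (y + 1) * U (k + 2) (x + 2) (y + 1) =
      U (k + 1) (x + 2) (y + 2) * T (k + 3) (x + 2) y +
        T (k + 2) (x + 3) (y + 1) * U (k + 2) (x + 1) (y + 1) := by
    rw [mul_comm]
    refine (plucker_of_plucker (hU.ne_zero k (x + 1) y) (p₁₂ := U (k + 1) (x + 3) (y + 1))
      (p₁₄ := U (k + 2) (x + 2) y) (p₁₅ := T (k + 2) (x + 3) y) ?_ ?_ ?_).2
    · rw [hU.recurrence k (x + 1) y (by omega), mul_comm (U (k + 2) _ _)]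
    · rw [mul_comm, hside, add_comm]
    · rw [mul_comm, hcross, add_comm, mul_comm]
  have hdiag' : U (k + 2) (x + 1) (y + 1) * T (k + 2) (x + 2) (y + 2) =
      U (k + 1) (x + 2) (y + 2) * T (k + 3) (x + 1) (y + 1) +
        T (k + 2) (x + 2) (y + 1) * U (k + 2) (x + 1) (y + 2) := by
    refine (plucker_of_plucker (hU.ne_zero k x (y + 1)) (p₂₃ := U (k + 1) (x + 1) (y + 3))
      (p₃₄ := U (k + 2) x (y + 2)) (p₃₅ := T (k + 2) (x + 1) (y + 2)) ?_ ?_ ?_).1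
    · rw [hU.recurrence k x (y + 1) (by omega), mul_comm (U (k + 2) _ _)]
    · rw [mul_comm, hside', add_comm]
    · rw [mul_comm, hcross', add_comm, mul_comm]
  refine plucker_of_plucker (hT.ne_zero (k + 1) (x + 1) y) (p₃₄ := T (k + 3) (x + 1) (y + 1))
    (p₂₃ := T (k + 3) (x + 2) y) (p₁₂ := T (k + 2) (x + 3) (y + 1))
    (hT.recurrence (k + 1) (x + 1) y (by omega)) ?_ ?_
  · rw [hdiag, add_comm]
  · rw [mul_comm, hdiag', add_comm, mul_comm]

theorem crossRecurrence_succ (hT : IsPaddedSolution T) (hU : IsPaddedSolution U)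
    (hc : ∀ x y, U 1 (x + 1) y = c * T 1 (x + 2) y) {k : ℕ}
    (hside : ∀ x y, SideRecurrence T U k x y) (x y : ℕ) : CrossRecurrence T U (k + 1) x y := by
  induction x generalizing y with
  | zero => exact crossRecurrence_x_zero hT hU hc k y
  | succ x ihx =>
    induction y with
    | zero => exact crossRecurrence_y_zero hT hU (k + 1) (x + 1)
    | succ y ihy =>
      exact (crossRecurrence_and_sideRecurrence hT hU (hside _ _) (hside _ _) ihy (ihx _)).1

theorem sideRecurrence (hT : IsPaddedSolution T) (hU : IsPaddedSolution U)
    (hc : ∀ x y, U 1 (x + 1) y = c * T 1 (x + 2) y) (k x y : ℕ) : SideRecurrence T U k x y := by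
  induction k generalizing x y with
  | zero => exact sideRecurrence_zero hT hU hc x y
  | succ k ih =>
    cases x with
    | zero => exact sideRecurrence_x_zero hT hU (k + 1) y
    | succ x =>
      have hcross := crossRecurrence_succ hT hU hc ih
      exact (crossRecurrence_and_sideRecurrence hT hU (ih _ _) (ih _ _) (hcross _ _)
        (hcross _ _)).2

theorem crossRecurrence (hT : IsPaddedSolution T) (hU : IsPaddedSolution U)
    (hc : ∀ x y, U 1 (x + 1) y = c * T 1 (x + 2) y) {k x : ℕ} (h : k + x ≠ 0) (y : ℕ) :
    CrossRecurrence T U k x y := by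
  rcases k with _ | k
  · obtain ⟨x, rfl⟩ := Nat.exists_eq_succ_of_ne_zero (show x ≠ 0 by omega)
    exact crossRecurrence_zero hU hc x y
  · exact crossRecurrence_succ hT hU hc (sideRecurrence hT hU hc k) x y

end IsPaddedSolution

end Bilinear

section Evolution

variable {F : Type*} [ZeroFreeSemifield F]

instance : Semifield (WithZero F) where
  __ := (inferInstance : AddCommMonoid (WithZero F))
  __ := (inferInstance : Distrib (WithZero F))
  __ := (inferInstance : CommGroupWithZero (WithZero F))
  nnqsmul := _
  nnqsmul_def _ _ := rfl

/-- The slice `T_g`: the evolution of the seed `s` shifted by `g` in its first argument, multiplied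
by `s g 0` and padded with zeros as in `IsPaddedSolution`. -/
def shiftedEvolution (s : ℕ → ℕ → F) (g : ℕ) : ℕ → ℕ → ℕ → WithZero F
  | k + 1, x + 1, y + 1 => (s g 0 * evolve (fun a b => s (g + a) b) k x y : F)
  | _, _, _ => 0

variable (s : ℕ → ℕ → F) (g : ℕ)

theorem shiftedEvolution_time_zero (x y : ℕ) : shiftedEvolution s g 0 x y = 0 := by
  simp only [shiftedEvolution]

theorem shiftedEvolution_x_zero (k y : ℕ) : shiftedEvolution s g k 0 y = 0 := by
  simp only [shiftedEvolution]

theorem shiftedEvolution_y_zero (k x : ℕ) : shiftedEvolution s g k x 0 = 0 := by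
  simp only [shiftedEvolution]

theorem shiftedEvolution_one (x y : ℕ) :
    shiftedEvolution s g 1 (x + 1) (y + 1) = ↑(s g 0 * s (g + x) y) := by
  rw [shiftedEvolution, evolve]

theorem isPaddedSolution_shiftedEvolution : IsPaddedSolution (shiftedEvolution s g) where
  time_zero := shiftedEvolution_time_zero s g
  x_zero := shiftedEvolution_x_zero s g
  y_zero := shiftedEvolution_y_zero s g
  ne_zero _ _ _ := WithZero.coe_ne_zero
  recurrence
    | k, 0, 0, h => absurd rfl h
    | k, x + 1, 0, _ => by
      rw [shiftedEvolution_y_zero, mul_zero, add_zero]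
      simp only [shiftedEvolution, ← WithZero.coe_mul]
      rw [evolve, mul_mul_mul_comm, mul_div_cancel, mul_mul_mul_comm]
    | k, 0, y + 1, _ => by
      rw [shiftedEvolution_x_zero, mul_zero, zero_add (_ * _)]
      simp only [shiftedEvolution, ← WithZero.coe_mul]
      rw [evolve, mul_mul_mul_comm, mul_div_cancel, mul_mul_mul_comm]
    | k, x + 1, y + 1, _ => by
      simp only [shiftedEvolution, ← WithZero.coe_mul, ← WithZero.coe_add]
      rw [evolve, mul_mul_mul_comm, mul_div_cancel, mul_add, mul_mul_mul_comm (s g 0) _ (s g 0),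
        mul_mul_mul_comm (s g 0) _ (s g 0)]
  corner k := by
    simp only [shiftedEvolution, ← WithZero.coe_mul]
    rw [evolve, mul_mul_mul_comm, mul_div_cancel, mul_mul_mul_comm]

theorem shiftedEvolution_succ_one :
    ∀ x y, shiftedEvolution s (g + 1) 1 (x + 1) y =
      ↑(s (g + 1) 0 / s g 0) * shiftedEvolution s g 1 (x + 2) y
  | x, 0 => by rw [shiftedEvolution_y_zero, shiftedEvolution_y_zero, mul_zero]
  | x, y + 1 => by
    rw [shiftedEvolution_one, shiftedEvolution_one, ← WithZero.coe_mul, ← mul_assoc,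
      div_mul_cancel, add_assoc, add_comm 1 x]

theorem shiftedEvolution_wall_y (k x : ℕ) :
    shiftedEvolution s g (k + 1) (x + 1) 1 = ↑(s (g + (x + k)) 0 * s g k) := by
  refine mul_left_cancel₀ ((isPaddedSolution_shiftedEvolution s g).ne_zero 0 0 0) ?_
  rw [(isPaddedSolution_shiftedEvolution s g).mul_wall_y, shiftedEvolution_one,
    shiftedEvolution_one, shiftedEvolution_one, ← WithZero.coe_mul, ← WithZero.coe_mul,
    mul_mul_mul_comm, add_zero]

theorem shiftedEvolution_wall_x (k y : ℕ) :
    shiftedEvolution s g (k + 1) 1 (y + 1) = ↑(s g (y + k) * s (g + k) 0) := by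
  refine mul_left_cancel₀ ((isPaddedSolution_shiftedEvolution s g).ne_zero 0 0 0) ?_
  rw [(isPaddedSolution_shiftedEvolution s g).mul_wall_x, shiftedEvolution_one,
    shiftedEvolution_one, shiftedEvolution_one, ← WithZero.coe_mul, ← WithZero.coe_mul,
    mul_mul_mul_comm, add_zero]

theorem shiftedEvolution_corner (k : ℕ) :
    shiftedEvolution s g 1 1 (k + 2) * shiftedEvolution s (g + 1) 1 1 (k + 1) =
      shiftedEvolution s g 2 1 (k + 1) * shiftedEvolution s g 1 2 (k + 1) := by
  simp only [shiftedEvolution_wall_x, shiftedEvolution_one, add_zero, WithZero.coe_mul]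
  ring

theorem shiftedEvolution_rotate {n : ℕ} {s s' : ℕ → ℕ → F}
    (h : ∀ x y, x + y ≤ n → s' x y = s (n - x - y) x) {k x y g : ℕ} (hn : k + x + y + g = n + 3) :
    shiftedEvolution s' 0 k x y = shiftedEvolution s g x y k := by
  induction k generalizing x y g with
  | zero => rw [shiftedEvolution_time_zero, shiftedEvolution_y_zero]
  | succ k ih =>
    induction hm : x + y using Nat.strong_induction_on generalizing x y g with
    | _ m ihm =>
    rcases x with _ | x
    · rw [shiftedEvolution_x_zero, shiftedEvolution_time_zero]
    rcases y with _ | y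
    · rw [shiftedEvolution_y_zero, shiftedEvolution_x_zero]
    rcases k with _ | k
    · rw [shiftedEvolution_one, shiftedEvolution_wall_y, h 0 0 (by omega), h (0 + x) y (by omega)]
      congr 3 <;> omega
    have hprev := ih (x := x + 1) (y := y + 1) (g := g + 1) (by omega)
    have hx := ih (x := x + 2) (y := y + 1) (g := g) (by omega)
    have hy := ih (x := x + 1) (y := y + 2) (g := g) (by omega)
    have hs' := isPaddedSolution_shiftedEvolution s' 0
    refine mul_left_cancel₀ (hs'.ne_zero k x y) ?_
    by_cases hxy : x + y = 0
    · obtain ⟨rfl, rfl⟩ : x = 0 ∧ y = 0 := by omega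
      rw [hs'.corner, hprev, hx, hy, mul_comm (shiftedEvolution s (g + 1) _ _ _),
        shiftedEvolution_corner]
    · have hcross := (isPaddedSolution_shiftedEvolution s g).crossRecurrence
        (isPaddedSolution_shiftedEvolution s (g + 1)) (shiftedEvolution_succ_one s g) hxy (k + 1)
      rw [hs'.recurrence k x y hxy, hprev, hx, hy,
        ihm (x + (y + 1)) (by omega) (g := g + 1) (by omega) rfl,
        ihm (x + 1 + y) (by omega) (g := g + 1) (by omega) rfl,
        mul_comm (shiftedEvolution s (g + 1) _ _ _), hcross]
      ring

end Evolution

section Maps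

variable {F : Type*} {n : ℕ}

/-- The reflection `t ↦ -t` of space-time, which exchanges the two triangles. -/
def timeReflection (p : ℤ × ℤ × ℤ) : ℤ × ℤ × ℤ := (p.1, p.2.1, -p.2.2)

theorem timeReflection_timeReflection (p : ℤ × ℤ × ℤ) :
    timeReflection (timeReflection p) = p := by
  simp only [timeReflection, neg_neg]

theorem mapsTo_timeReflection_quarter : Set.MapsTo timeReflection
    (latticePoints n (quarterOctahedron n)) (latticePoints n (quarterOctahedron n)) := by
  rintro ⟨x, y, t⟩ h
  rw [mem_latticePoints_quarter] at h
  simp only [timeReflection, mem_latticePoints_quarter]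
  omega

theorem mapsTo_timeReflection_lower : Set.MapsTo timeReflection
    (latticePoints n (lowerTriangle n)) (latticePoints n (upperTriangle n)) := by
  rintro ⟨x, y, t⟩ h
  rw [mem_latticePoints_lower] at h
  simp only [timeReflection, mem_latticePoints_upper]
  omega

theorem mapsTo_timeReflection_upper : Set.MapsTo timeReflection
    (latticePoints n (upperTriangle n)) (latticePoints n (lowerTriangle n)) := by
  rintro ⟨x, y, t⟩ h
  rw [mem_latticePoints_upper] at h
  simp only [timeReflection, mem_latticePoints_lower]
  omega

/-- The pullback of a state along the time reflection, for domains that the reflection maps into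
each other on lattice points. -/
def reflect {D E : Set (ℝ × ℝ × ℝ)}
    (h : Set.MapsTo timeReflection (latticePoints n D) (latticePoints n E)) (g : State F n E) :
    State F n D :=
  g ∘ h.restrict

theorem reflect_reflect {D E : Set (ℝ × ℝ × ℝ)}
    (hDE : Set.MapsTo timeReflection (latticePoints n D) (latticePoints n E))
    (hED : Set.MapsTo timeReflection (latticePoints n E) (latticePoints n D)) (g : State F n E) :
    reflect hED (reflect hDE g) = g :=
  funext fun p => congrArg g (Subtype.ext (timeReflection_timeReflection p.1))

theorem reflect_bijective {D E : Set (ℝ × ℝ × ℝ)}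
    (hDE : Set.MapsTo timeReflection (latticePoints n D) (latticePoints n E))
    (hED : Set.MapsTo timeReflection (latticePoints n E) (latticePoints n D)) :
    Function.Bijective (reflect (F := F) hDE) :=
  Function.bijective_iff_has_inverse.2
    ⟨reflect hED, reflect_reflect hDE hED, reflect_reflect hED hDE⟩

variable [ZeroFreeSemifield F]

theorem SatisfiesRecurrence.reflect {D E : Set (ℝ × ℝ × ℝ)}
    (h : Set.MapsTo timeReflection (latticePoints n D) (latticePoints n E)) {g : State F n E}
    (hg : SatisfiesRecurrence g) : SatisfiesRecurrence (Octahedron.reflect h g) := by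
  have hmem {x y s : ℤ} (t : ℤ) (hs : (x, y, s) ∈ latticePoints n D) (hst : -s = t) :
      (x, y, t) ∈ latticePoints n E := hst ▸ h hs
  have happly {x y s : ℤ} (t : ℤ) (hs : (x, y, s) ∈ latticePoints n D) (hst : -s = t) :
      Octahedron.reflect h g ⟨_, hs⟩ = g ⟨_, hmem t hs hst⟩ := by
    subst hst
    rfl
  have hup (t : ℤ) : -(t + 1) = -t - 1 := neg_add' t 1
  have hdown (t : ℤ) : -(t - 1) = -t + 1 := by ring
  refine ⟨?_, ?_, ?_, ?_⟩
  · intro x y t hx hy hu hd he hw hn hs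
    rw [happly _ hu (hup t), happly _ hd (hdown t),
      hg.interior x y (-t) hx hy _ (hmem _ hu (hup t)) (h he) (h hw) (h hn) (h hs)]
    exact (div_div_cancel _ _).symm
  · intro x t hx hu hd he hw
    rw [happly _ hu (hup t), happly _ hd (hdown t),
      hg.wall_y x (-t) hx _ (hmem _ hu (hup t)) (h he) (h hw)]
    exact (div_div_cancel _ _).symm
  · intro y t hy hu hd hn hs
    rw [happly _ hu (hup t), happly _ hd (hdown t),
      hg.wall_x y (-t) hy _ (hmem _ hu (hup t)) (h hn) (h hs)]
    exact (div_div_cancel _ _).symm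
  · intro t hu hd he hn
    rw [happly _ hu (hup t), happly _ hd (hdown t),
      hg.corner (-t) _ (hmem _ hu (hup t)) (h he) (h hn)]
    exact (div_div_cancel _ _).symm

theorem reflect_extend (f : State F n (lowerTriangle n)) :
    reflect mapsTo_timeReflection_quarter (extend f) =
      extend (reflect mapsTo_timeReflection_lower (phi f)) :=
  eq_extend ((extend_spec f).1.reflect _) rfl

theorem reflect_comp_phi_involutive :
    Function.Involutive (reflect (F := F) (n := n) mapsTo_timeReflection_lower ∘ phi) := by
  intro f
  calc reflect mapsTo_timeReflection_lower (phi (reflect mapsTo_timeReflection_lower (phi f)))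
      = reflect mapsTo_timeReflection_lower (restrict (upper_subset n)
          (reflect mapsTo_timeReflection_quarter (extend f))) := by rw [phi, reflect_extend]
    _ = restrict (lower_subset n) (reflect mapsTo_timeReflection_quarter
          (reflect mapsTo_timeReflection_quarter (extend f))) := rfl
    _ = f := by rw [reflect_reflect, (extend_spec f).2]

theorem phi_bijective : Function.Bijective (phi (F := F) (n := n)) :=
  (Function.Bijective.of_comp_iff'
    (reflect_bijective mapsTo_timeReflection_lower mapsTo_timeReflection_upper) phi).1
    reflect_comp_phi_involutive.bijective

theorem phiBar_bijective : Function.Bijective (phiBar (F := F) (n := n)) := by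
  constructor
  · rintro ⟨f⟩ ⟨g⟩ h
    obtain ⟨c, hc⟩ := Quotient.exact h
    exact Quotient.sound ⟨c, phi_bijective.injective ((phi_smul c g).trans hc)⟩
  · rintro ⟨g⟩
    obtain ⟨f, rfl⟩ := phi_bijective.surjective g
    exact ⟨projClass f, rfl⟩

theorem seed_apply (f : State F n (lowerTriangle n)) (p : latticePoints n (lowerTriangle n))
    {x y : ℕ} (h : p.1 = ((x : ℤ), (y : ℤ), (x : ℤ) + y - n)) : seed f x y = f p := by
  rw [seed, dif_pos (h ▸ p.2)]
  exact congrArg f (Subtype.ext h.symm)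

theorem phi_apply (f : State F n (lowerTriangle n)) (p : latticePoints n (upperTriangle n))
    {x y z : ℕ} (h : p.1 = ((x : ℤ), (y : ℤ), (z : ℤ))) : phi f p = evolve (seed f) z x y := by
  have hp := p.2
  rw [h, mem_latticePoints_upper] at hp
  rw [phi, ← eq_extend (evolved_satisfies f) (restrict_evolved f)]
  refine evolved_apply f _ z x y ?_
  simp only [h, Prod.mk.injEq, true_and]
  omega

theorem seed_mul_phi_apply (f : State F n (lowerTriangle n))
    (p : latticePoints n (upperTriangle n)) {x y z : ℕ} (h : p.1 = ((x : ℤ), (y : ℤ), (z : ℤ))) :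
    ↑(seed f 0 0 * phi f p) = shiftedEvolution (seed f) 0 (z + 1) (x + 1) (y + 1) := by
  simp only [shiftedEvolution, zero_add, phi_apply f p h]

theorem seed_comp_r (f : State F n (lowerTriangle n)) {x y : ℕ} (h : x + y ≤ n) :
    seed (f ∘ r) x y = seed f (n - x - y) x := by
  have hp : ((x : ℤ), (y : ℤ), (x : ℤ) + y - n) ∈ latticePoints n (lowerTriangle n) := by
    rw [mem_latticePoints_lower]; omega
  rw [seed_apply (f ∘ r) ⟨_, hp⟩ rfl, seed_apply f (r ⟨_, hp⟩) (x := n - x - y) (y := x)]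
  · rfl
  · dsimp only [r]
    rw [Prod.mk.injEq, Prod.mk.injEq]
    omega

theorem phi_comp_r (f : State F n (lowerTriangle n)) :
    phi (f ∘ r) = (seed f 0 0 / seed (f ∘ r) 0 0) • (phi f ∘ r') := by
  funext ⟨⟨x, y, z⟩, hp⟩
  have h := mem_latticePoints_upper.1 hp
  lift x to ℕ using h.1
  lift y to ℕ using h.2.1
  lift z to ℕ using by omega
  have key : seed (f ∘ r) 0 0 * phi (f ∘ r) ⟨_, hp⟩ = seed f 0 0 * phi f (r' ⟨_, hp⟩) := by
    rw [← WithZero.coe_inj, seed_mul_phi_apply (f ∘ r) ⟨_, hp⟩ rfl,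
      seed_mul_phi_apply f (r' ⟨_, hp⟩) rfl]
    exact shiftedEvolution_rotate (fun _ _ => seed_comp_r f) (by omega)
  rw [Pi.smul_apply, Function.comp_apply, smul_eq_mul, div_mul_eq_mul_div, ← key,
    mul_div_cancel_left]

theorem pullback_comp_phiBar :
    pullback (F := F) (r' (n := n)) ∘ phiBar = phiBar ∘ pullback (F := F) (r (n := n)) := by
  refine funext fun q => Quotient.inductionOn q fun f => ?_
  have h : phi (f ∘ r) ∈ MulAction.orbit F (phi f ∘ r') := ⟨_, (phi_comp_r f).symm⟩
  exact (Quotient.sound h).symm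

end Maps

end Octahedron

theorem mainTheorem3 {F : Type*} [Octahedron.ZeroFreeSemifield F] (n : ℕ) :
    Function.Bijective (Octahedron.phi (F := F) (n := n)) ∧
    Function.Bijective (Octahedron.phiBar (F := F) (n := n)) ∧
    Octahedron.pullback (F := F) (Octahedron.r' (n := n)) ∘ Octahedron.phiBar =
      Octahedron.phiBar ∘ Octahedron.pullback (F := F) (Octahedron.r (n := n)) :=
  ⟨Octahedron.phi_bijective, Octahedron.phiBar_bijective, Octahedron.pullback_comp_phiBar⟩
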